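/- Let $Y$ be a complex Banach space, $n\in\mathbb N$, $X=Y^n$, and let a complex $n\times n$ matrix $A$ act on $X$ by $(Ax)_i=\sum_j A_{ij}x_j$. Let $\mathbb J\in\{\mathbb R,[0,\infty)\}$, write $BUC$ for the bounded uniformly continuous functions and $L(X)$ for the bounded linear operators on $X$, and let $\mathcal F$ be a class of functions $\mathbb J\to X$ such that 1. $\mathcal F$ is a complex linear space of locally Bochner integrable functions; 2. if $f_k\in\mathcal F\cap BUC(\mathbb J,X)$ $(k\in\mathbb N)$ and $f_k\to g$ uniformly on $\mathbb J$, then $g\in\mathcal F$; 3. if $f\in BUC(\mathbb R,X)$ and $f|_{\mathbb J}\in\mathcal F$, then $f(a+\cdot)|_{\mathbb J}\in\mathcal F$ for all $a\in\mathbb R$; 4. if $f\in BUC(\mathbb R,X)$ and $f|_{\mathbb J}\in\mathcal F$, then $(B\circ f)|_{\mathbb J}\in\mathcal F$ for all $B\in L(X)$. Let $\mathcal{MF}$ be the set of all $f\in L^1_{loc}(\mathbb J,X)$ such that for every $h>0$ the function $t\mapsto \frac1h\int_0^h f(t+s)\,ds$ on $\mathbb J$ belongs to $\mathcal F$. For $\phi\in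 L^\infty(\mathbb R,X)$ let $$sp(\phi)=\Big\{\omega\in\mathbb R:\ \text{for all } f\in L^1(\mathbb R,\mathbb C),\ \phi*f=0 \text{ implies } \int_{\mathbb R} f(t)e^{-i\omega t}\,dt=0\Big\}$$ be its Beurling spectrum. Let $\phi\in L^\infty(\mathbb R,X)$ with $\phi|_{\mathbb J}\in\mathcal{MF}$, and suppose that for no $\omega\in sp(\phi)$ is $i\omega$ an eigenvalue of $A$ (in particular, $0$ is not an eigenvalue of $A$ if $0\in sp(\phi)$). Then $u'=Au+\phi$ has a mild solution $u$ on $\mathbb R$, that is, a continuous $u:\mathbb R\to X$ with $$u(t)=u(0)+A\int_0^t u(s)\,ds+\int_0^t\phi(s)\,ds\qquad(t\in\mathbb R),$$ such that $u\in BUC(\mathbb R,X)$ and $u|_{\mathbb J}\in\mathcal F$. -/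

import Mathlib

open MeasureTheory Filter Topology

noncomputable section

/-- `f` is bounded and uniformly continuous. -/
def IsBUC {α X : Type*} [UniformSpace α] [NormedAddCommGroup X] (f : α → X) : Prop :=
  UniformContinuous f ∧ ∃ C : ℝ, ∀ t, ‖f t‖ ≤ C

/-- The Beurling spectrum of `φ ∈ L^∞(ℝ, X)`: the real `ω` such that every `f ∈ L¹(ℝ, ℂ)` with
`φ * f = 0` has `f̂(ω) = ∫ f(t) e^{-iωt} dt = 0`. -/
def beurlingSpectrum {X : Type*} [NormedAddCommGroup X] [NormedSpace ℂ X] (φ : ℝ → X) : Set ℝ :=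
  {ω : ℝ | ∀ f : ℝ → ℂ, Integrable f volume → (∀ t : ℝ, ∫ s : ℝ, f s • φ (t - s) = 0) →
    ∫ t : ℝ, f t * Complex.exp (-(Complex.I * ω * t)) = 0}

/-- The mean `(M_h f)(t) = (1/h) ∫_0^h f(t+s) ds` of a function `f` on `J`. For `h > 0` and
`J = ℝ` or `J = [0, ∞)` one has `t + s ∈ J` for all `t ∈ J`, `s ∈ [0, h]`, so the values of the
extension of `f` by zero outside `J` are not used. -/
def translationMean {X : Type*} [NormedAddCommGroup X] [NormedSpace ℂ X] {J : Set ℝ}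
    (h : ℝ) (f : J → X) : J → X :=
  fun t => ((h⁻¹ : ℝ) : ℂ) • ∫ s in (0 : ℝ)..h, Function.extend Subtype.val f 0 ((t : ℝ) + s)

/-- The mean class `𝓜 F = {f ∈ L¹_loc(J, X) : M_h f ∈ F for all h > 0}`. -/
def meanClass {X : Type*} [NormedAddCommGroup X] [NormedSpace ℂ X] {J : Set ℝ}
    (F : Set (J → X)) : Set (J → X) :=
  {f | LocallyIntegrable f (Measure.comap Subtype.val volume) ∧ ∀ h : ℝ, 0 < h → translationMean h f ∈ F}

/-- The conditions on a linear space `F` of functions on `J`. -/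
structure IsBUCInvariantClass {X : Type*} [NormedAddCommGroup X] [NormedSpace ℂ X] {J : Set ℝ}
    (F : Submodule ℂ (J → X)) : Prop where
  /-- `F` consists of locally integrable functions. -/
  locallyIntegrable : ∀ f ∈ F, LocallyIntegrable f (Measure.comap Subtype.val volume)
  /-- Uniform limits of sequences of bounded uniformly continuous members of `F` are in `F`. -/
  uniform_limit : ∀ (f : ℕ → J → X) (g : J → X), (∀ n, f n ∈ F ∧ IsBUC (f n)) →
    TendstoUniformly f g atTop → g ∈ F
  /-- BUC-invariance under translations. -/
  translate : ∀ f : ℝ → X, IsBUC f → J.domRestrict f ∈ F →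
    ∀ a : ℝ, J.domRestrict (fun t => f (a + t)) ∈ F
  /-- Invariance under bounded linear operators on `X`. -/
  comp_clm : ∀ f : ℝ → X, IsBUC f → J.domRestrict f ∈ F →
    ∀ B : X →L[ℂ] X, J.domRestrict (fun t => B (f t)) ∈ F

/-- `u` is a mild solution on `ℝ` of `u' = A u + φ`, for an everywhere defined bounded `A`
(so that `∫_0^t u ∈ D(A)` holds automatically). -/
def IsMildSolution {X : Type*} [NormedAddCommGroup X] [NormedSpace ℂ X]
    (A : X →L[ℂ] X) (φ u : ℝ → X) : Prop :=
  Continuous u ∧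
    ∀ t : ℝ, u t = u 0 + A (∫ s in (0 : ℝ)..t, u s) + ∫ s in (0 : ℝ)..t, φ s

/-- The operator `(A x)_i = ∑ j, A i j • x j` on `Y^n` given by a complex `n × n` matrix `A`. -/
def matrixOperator {n : ℕ} (Y : Type*) [NormedAddCommGroup Y] [NormedSpace ℂ Y]
    (A : Matrix (Fin n) (Fin n) ℂ) : (Fin n → Y) →L[ℂ] (Fin n → Y) :=
  ContinuousLinearMap.pi fun i => ∑ j, A i j • ContinuousLinearMap.proj (R := ℂ) j

end

/-! Everything happens in one closed translation invariant space `N` (`annihilatedClass`): the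
bounded uniformly continuous functions whose restriction lies in `F` and which are annihilated by
every integrable `f` with `φ * f = 0`. Membership of the solution in `F` then comes for free from
solving inside `N`, and the spectrum of `φ` controls all of `N` at once.

The function `φ` need not belong to `N`, but its increments `∫_t^{t+h} φ` do, and averaging them
over `h` gives `φ = v' + D` in integrated form with `v, D ∈ N` (`exists_primitive_sub_increment`).
Putting `u = v + w` leaves `w' = A w + (A v + D)` with forcing in `N`.

By Cayley-Hamilton a product of factors `A - μ`, with `μ` an eigenvalue of the matrix, vanishes on
`Y^n`. Peeling off one factor at a time (`exists_hasDerivAt_of_aeval`) reduces the system to scalar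
equations `v' = μ v + ψ` in `N`. Off the imaginary axis a Laplace integral of translates solves
them. On the axis the spectral hypothesis provides an `f` annihilating `N` with nonzero transform at
`μ`; this bounds the solutions for `μ + α` uniformly as `α ↓ 0`, and they converge
(`exists_hasDerivAt_of_isNonresonant`). -/

open BoundedContinuousFunction in
/-- Translation by `a` on the bounded continuous functions on the line. -/
noncomputable def translateBCF {X : Type*} [NormedAddCommGroup X] [NormedSpace ℂ X] (a : ℝ) :
    (ℝ →ᵇ X) →L[ℂ] (ℝ →ᵇ X) :=
  compContinuousCLM X ℂ ⟨fun t => a + t, by fun_prop⟩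

open BoundedContinuousFunction in
/-- Reflection on the bounded continuous functions on the line. -/
noncomputable def reflectBCF {X : Type*} [NormedAddCommGroup X] [NormedSpace ℂ X] :
    (ℝ →ᵇ X) →L[ℂ] (ℝ →ᵇ X) :=
  compContinuousCLM X ℂ ⟨fun t => -t, by fun_prop⟩

open BoundedContinuousFunction in
/-- A closed translation invariant space of bounded uniformly continuous functions. -/
structure IsTranslationSpace {X : Type*} [NormedAddCommGroup X] [NormedSpace ℂ X]
    (N : Submodule ℂ (ℝ →ᵇ X)) : Prop where
  isClosed : IsClosed (N : Set (ℝ →ᵇ X))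
  uniformContinuous : ∀ ψ ∈ N, UniformContinuous ψ
  translate_mem : ∀ ψ ∈ N, ∀ a, translateBCF a ψ ∈ N

namespace IsTranslationSpace

open BoundedContinuousFunction

/-! ### Closed translation invariant spaces; scalar equations off the imaginary axis. -/

section General

variable {X : Type*} [NormedAddCommGroup X] [NormedSpace ℂ X]

@[simp] lemma translateBCF_apply (a : ℝ) (ψ : ℝ →ᵇ X) (t : ℝ) :
    translateBCF a ψ t = ψ (a + t) := rfl

@[simp] lemma reflectBCF_apply (ψ : ℝ →ᵇ X) (t : ℝ) : reflectBCF ψ t = ψ (-t) := rfl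

lemma norm_translateBCF_le (a : ℝ) (ψ : ℝ →ᵇ X) : ‖translateBCF a ψ‖ ≤ ‖ψ‖ :=
  (norm_le (norm_nonneg _)).2 fun t => norm_coe_le_norm ψ (a + t)

lemma continuous_translateBCF {ψ : ℝ →ᵇ X} (h : UniformContinuous ψ) :
    Continuous fun a : ℝ => translateBCF a ψ := by
  rw [Metric.continuous_iff]
  intro b ε hε
  obtain ⟨δ, hδ, H⟩ := Metric.uniformContinuous_iff.1 h (ε / 2) (half_pos hε)
  refine ⟨δ, hδ, fun a ha => ?_⟩
  refine ((dist_le (half_pos hε).le).2 fun t => ?_).trans_lt (half_lt_self hε)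
  exact (H (by simpa [Real.dist_eq] using ha)).le

/-- A closed subspace of a complete space is complete, so the integral can be formed inside it; an
isometric embedding commutes with the integral without any integrability assumption. -/
lemma integral_mem_of_isClosed {E α : Type*} [NormedAddCommGroup E] [NormedSpace ℂ E]
    [CompleteSpace E] [MeasurableSpace α] {μ : Measure α} {N : Submodule ℂ E}
    (hN : IsClosed (N : Set E)) {f : α → E} (hf : ∀ x, f x ∈ N) : ∫ x, f x ∂μ ∈ N := by
  have : CompleteSpace N := hN.completeSpace_coe
  have := N.subtypeₗᵢ.integral_comp_comm (μ := μ) fun x => (⟨f x, hf x⟩ : N)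
  change ∫ x, f x ∂μ = _ at this
  rw [this]
  exact Subtype.mem _

variable {N : Submodule ℂ (ℝ →ᵇ X)}

/-- The reflection of a translation space is a translation space. -/
lemma comap_reflect (hN : IsTranslationSpace N) :
    IsTranslationSpace (N.comap (reflectBCF (X := X)).toLinearMap) where
  isClosed := hN.isClosed.preimage (reflectBCF (X := X)).continuous
  uniformContinuous ψ hψ := by
    have h := (hN.uniformContinuous _ hψ).comp (uniformContinuous_id (α := ℝ)).neg
    exact h.congr fun t => by simp
  translate_mem ψ hψ a := by
    have h := hN.translate_mem _ hψ (-a)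
    have e : reflectBCF (translateBCF a ψ) = translateBCF (-a) (reflectBCF ψ) := by
      ext t; simp [add_comm]
    change reflectBCF (translateBCF a ψ) ∈ N
    rw [e]; exact h

variable [CompleteSpace X]

/-- For `Re μ > 0` the equation `v' = μ v + ψ` is solvable in every translation space. -/
lemma exists_hasDerivAt_of_re_pos (hN : IsTranslationSpace N) {μ : ℂ} (hμ : 0 < μ.re)
    {ψ : ℝ →ᵇ X} (hψ : ψ ∈ N) :
    ∃ v ∈ N, ∀ t, HasDerivAt v (μ • v t + ψ t) t := by
  have hE : ∀ a : ℝ, IntegrableOn (fun s : ℝ => Complex.exp (-μ * s)) (Set.Ioi a) := fun a =>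
    integrableOn_exp_mul_complex_Ioi (by simpa using hμ) a
  have hcont : Continuous fun s : ℝ => Complex.exp (-μ * s) := by fun_prop
  have hI : IntegrableOn (fun s : ℝ => Complex.exp (-μ * s) • translateBCF s ψ) (Set.Ioi 0) := by
    refine Integrable.smul_bdd (hE 0) ‖ψ‖ ?_ ?_
    · exact (continuous_translateBCF (hN.uniformContinuous _ hψ)).aestronglyMeasurable
    · exact ae_of_all _ fun s => norm_translateBCF_le s ψ
  have hg : ∀ a : ℝ, IntegrableOn (fun s : ℝ => Complex.exp (-μ * s) • ψ s) (Set.Ioi a) := by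
    intro a
    refine Integrable.smul_bdd (hE a) ‖ψ‖ ψ.continuous.aestronglyMeasurable ?_
    exact ae_of_all _ fun s => norm_coe_le_norm ψ s
  -- The resolvent of the translation group at `μ`, as a Bochner integral in the sup norm, so that
  -- it stays in `N`.
  refine ⟨-∫ s in Set.Ioi (0 : ℝ), Complex.exp (-μ * s) • translateBCF s ψ, N.neg_mem
    (integral_mem_of_isClosed hN.isClosed fun s => N.smul_mem _ (hN.translate_mem _ hψ s)), ?_⟩
  set v : ℝ →ᵇ X := -∫ s in Set.Ioi (0 : ℝ), Complex.exp (-μ * s) • translateBCF s ψ with hv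
  set c : X := ∫ s in Set.Ioi (0 : ℝ), Complex.exp (-μ * s) • ψ s with hc
  -- Evaluation at `t` and a shift of variable turn the integral into a variation of constants
  -- formula, which can be differentiated directly.
  have key : ∀ t, v t = Complex.exp (μ * t) •
      ((∫ s in (0 : ℝ)..t, Complex.exp (-μ * s) • ψ s) - c) := by
    intro t
    have h1 : v t = -∫ s in Set.Ioi (0 : ℝ), Complex.exp (-μ * s) • ψ (s + t) := by
      rw [hv, coe_neg, Pi.neg_apply]
      congr 1
      exact ((evalCLM ℂ t).integral_comp_comm hI).symm
    have h2 : ∫ s in Set.Ioi (0 : ℝ), Complex.exp (-μ * s) • ψ (s + t) =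
        Complex.exp (μ * t) • ∫ s in Set.Ioi t, Complex.exp (-μ * s) • ψ s := by
      have := (measurePreserving_add_right volume t).setIntegral_preimage_emb
        (measurableEmbedding_addRight t) (fun s : ℝ => Complex.exp (-μ * s) • ψ s) (Set.Ioi t)
      rw [← this, ← integral_smul]
      simp only [Set.preimage_add_const_Ioi, sub_self]
      refine setIntegral_congr_fun measurableSet_Ioi fun s _ => ?_
      simp only [smul_smul, ← Complex.exp_add]
      congr 2
      push_cast; ring
    rw [h1, h2, ← smul_neg, ← intervalIntegral.integral_Ioi_sub_Ioi' (hg 0) (hg t)]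
    congr 1
    abel
  intro t
  have hd1 : HasDerivAt (fun t : ℝ => Complex.exp (μ * t)) (Complex.exp (μ * t) * μ) t := by
    have : HasDerivAt (fun t : ℝ => μ * (t : ℂ)) μ t := by
      simpa using (Complex.ofRealCLM.hasDerivAt (x := t)).const_mul μ
    exact this.cexp
  have hcg : Continuous fun s : ℝ => Complex.exp (-μ * s) • ψ s := hcont.smul ψ.continuous
  have hd2 : HasDerivAt (fun t : ℝ => (∫ s in (0 : ℝ)..t, Complex.exp (-μ * s) • ψ s) - c)
      (Complex.exp (-μ * t) • ψ t) t :=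
    (intervalIntegral.integral_hasDerivAt_right (hcg.intervalIntegrable _ _)
      (hcg.stronglyMeasurableAtFilter _ _) hcg.continuousAt).sub_const c
  have hd := hd1.smul hd2
  have e : (v : ℝ → X) = fun t : ℝ => Complex.exp (μ * t) •
      ((∫ s in (0 : ℝ)..t, Complex.exp (-μ * s) • ψ s) - c) := funext key
  have e2 : μ • v t + ψ t = Complex.exp (μ * t) • Complex.exp (-μ * t) • ψ t +
      (Complex.exp (μ * t) * μ) • ((∫ s in (0 : ℝ)..t, Complex.exp (-μ * s) • ψ s) - c) := by
    rw [key t, smul_smul, smul_smul, ← Complex.exp_add, mul_comm μ (Complex.exp _)]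
    simp [add_comm]
  rw [e2, e]
  exact hd

/-- For `Re μ ≠ 0` the equation `v' = μ v + ψ` is solvable in every translation space. -/
lemma exists_hasDerivAt_of_re_ne_zero (hN : IsTranslationSpace N) {μ : ℂ} (hμ : μ.re ≠ 0)
    {ψ : ℝ →ᵇ X} (hψ : ψ ∈ N) :
    ∃ v ∈ N, ∀ t, HasDerivAt v (μ • v t + ψ t) t := by
  rcases lt_or_gt_of_ne hμ with h | h
  -- Time reversal replaces `μ, ψ` by `-μ, -ψ(-·)` and leads back to positive real part.
  · have hm : -reflectBCF ψ ∈ N.comap (reflectBCF (X := X)).toLinearMap := by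
      have e : reflectBCF (-reflectBCF ψ) = -ψ := by ext t; simp
      change reflectBCF (-reflectBCF ψ) ∈ N
      rw [e]
      exact N.neg_mem hψ
    obtain ⟨v, hv, hd⟩ := hN.comap_reflect.exists_hasDerivAt_of_re_pos (μ := -μ)
      (by simpa using h) hm
    refine ⟨reflectBCF v, hv, fun t => ?_⟩
    have := (hd (-t)).scomp t (hasDerivAt_neg t)
    have e : (-1 : ℝ) • ((-μ) • v (-t) + (-reflectBCF ψ) (-t)) =
        μ • (reflectBCF v) t + ψ t := by
      simp [add_comm]
    rw [e] at this
    exact this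
  · exact hN.exists_hasDerivAt_of_re_pos h hψ

end General

/-! ### Scalar equations on the imaginary axis and the reduction of systems to them. -/

section Resonance

variable {X : Type*} [NormedAddCommGroup X] [NormedSpace ℂ X]

/-- Dominated convergence as `δ ↓ 0`. Truncating the weight at `1` avoids any assumption on the
first moment of `f`. -/
lemma exists_integral_norm_mul_min_le {f : ℝ → ℂ} (hf : Integrable f) {ε : ℝ} (hε : 0 < ε) :
    ∃ δ > 0, ∫ s, ‖f s‖ * min 1 (δ * |s|) ≤ ε := by
  have hlim : Tendsto (fun δ : ℝ => ∫ s, ‖f s‖ * min 1 (δ * |s|)) (𝓝[>] 0)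
      (𝓝 (∫ _ : ℝ, (0 : ℝ))) := by
    refine tendsto_integral_filter_of_dominated_convergence (fun s => ‖f s‖) ?_ ?_ hf.norm ?_
    · refine Eventually.of_forall fun δ => hf.norm.aestronglyMeasurable.mul ?_
      exact Continuous.aestronglyMeasurable (by fun_prop)
    · filter_upwards [self_mem_nhdsWithin] with δ hδ
      refine ae_of_all _ fun s => ?_
      have h0 : 0 ≤ min 1 (δ * |s|) := le_min zero_le_one (mul_nonneg (le_of_lt hδ) (abs_nonneg s))
      rw [Real.norm_of_nonneg (mul_nonneg (norm_nonneg _) h0)]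
      exact mul_le_of_le_one_right (norm_nonneg _) (min_le_left _ _)
    · refine ae_of_all _ fun s => ?_
      have hc : Continuous fun δ : ℝ => ‖f s‖ * min 1 (δ * |s|) := by fun_prop
      have := (hc.tendsto 0).mono_left (nhdsWithin_le_nhds (s := Set.Ioi 0))
      simpa using this
  rw [integral_zero] at hlim
  obtain ⟨δ, h1, h2⟩ := ((hlim.eventually (ge_mem_nhds hε)).and self_mem_nhdsWithin).exists
  exact ⟨δ, h2, h1⟩

/-- A priori estimate for bounded solutions of `z' = (μ + α) z + χ` annihilated by convolution
with a function whose Fourier-Laplace transform does not vanish at the imaginary number `μ`. -/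
lemma exists_norm_le_of_hasDerivAt [CompleteSpace X] {f : ℝ → ℂ} (hf : Integrable f) {μ : ℂ}
    (hμ : μ.re = 0) (hc : ∫ s : ℝ, f s * Complex.exp (-μ * s) ≠ 0) :
    ∃ δ > 0, ∀ α : ℝ, 0 ≤ α → α ≤ δ → ∀ z χ : ℝ →ᵇ X, (∀ t, ∫ s, f s • z (t - s) = 0) →
      (∀ t, HasDerivAt z ((μ + α) • z t + χ t) t) → ‖z‖ ≤ ‖χ‖ / δ := by
  set c : ℂ := ∫ s : ℝ, f s * Complex.exp (-μ * s) with hcdef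
  have hcpos : 0 < ‖c‖ := norm_pos_iff.2 hc
  -- The factor `2 * M` below turns `‖c‖ / 4` into half of `‖c‖ * M`, so `‖z‖` can be absorbed at
  -- the end. This `δ` depends on neither `α` nor `z`.
  obtain ⟨δ, hδ, hint⟩ := exists_integral_norm_mul_min_le hf (ε := ‖c‖ / 4) (by positivity)
  refine ⟨δ, hδ, fun α hα0 hα z χ hfz hz => ?_⟩
  have hexp : ∀ x : ℝ, ‖Complex.exp (μ * x)‖ = 1 := fun x => by
    simp [Complex.norm_exp, hμ]
  have hexp' : ∀ x : ℝ, ‖Complex.exp (-μ * x)‖ = 1 := fun x => by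
    simp [Complex.norm_exp, hμ]
  -- Removing the oscillation `exp (μ t)` leaves a function whose derivative is small when `α` and
  -- `χ` are.
  have hy : ∀ t : ℝ, HasDerivAt (fun t : ℝ => Complex.exp (-μ * t) • z t)
      (Complex.exp (-μ * t) • ((α : ℂ) • z t + χ t)) t := by
    intro t
    have h0 : HasDerivAt (fun t : ℝ => -μ * (t : ℂ)) (-μ) t := by
      simpa using (Complex.ofRealCLM.hasDerivAt (x := t)).const_mul (-μ)
    refine (h0.cexp.smul (hz t)).congr_deriv ?_
    module
  have hlip : ∀ a b : ℝ, ‖Complex.exp (-μ * b) • z b - Complex.exp (-μ * a) • z a‖ ≤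
      (α * ‖z‖ + ‖χ‖) * ‖b - a‖ := by
    intro a b
    refine Convex.norm_image_sub_le_of_norm_hasDerivWithin_le (s := Set.univ)
      (fun x _ => (hy x).hasDerivWithinAt) (fun x _ => ?_) convex_univ (Set.mem_univ _)
      (Set.mem_univ _)
    rw [norm_smul, hexp', one_mul]
    refine (norm_add_le _ _).trans (add_le_add ?_ (norm_coe_le_norm _ _))
    rw [norm_smul, Complex.norm_real, Real.norm_of_nonneg hα0]
    exact mul_le_mul_of_nonneg_left (norm_coe_le_norm _ _) hα0
  -- Chosen so that the Lipschitz constant `α * ‖z‖ + ‖χ‖` is at most `δ * M`.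
  set M : ℝ := ‖z‖ + ‖χ‖ / δ with hM
  have hM0 : 0 ≤ M := by positivity
  have hdiff : ∀ t s : ℝ, ‖Complex.exp (-μ * s) • z t - z (t - s)‖ ≤ 2 * M * min 1 (δ * |s|) := by
    intro t s
    have e : Complex.exp (-μ * s) • z t - z (t - s) = Complex.exp (μ * (t - s : ℝ)) •
        (Complex.exp (-μ * t) • z t - Complex.exp (-μ * (t - s : ℝ)) • z (t - s)) := by
      rw [smul_sub, smul_smul, smul_smul, ← Complex.exp_add, ← Complex.exp_add]
      have e1 : μ * ((t - s : ℝ) : ℂ) + -μ * t = -μ * s := by push_cast; ring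
      have e2 : μ * ((t - s : ℝ) : ℂ) + -μ * ((t - s : ℝ) : ℂ) = 0 := by ring
      rw [e1, e2, Complex.exp_zero, one_smul]
    rcases le_total 1 (δ * |s|) with h | h
    · rw [min_eq_left h]
      have h1 : ‖Complex.exp (-μ * s) • z t‖ ≤ ‖z‖ := by
        rw [norm_smul, hexp', one_mul]; exact norm_coe_le_norm _ _
      have h2 := norm_coe_le_norm z (t - s)
      have h3 : 0 ≤ ‖χ‖ / δ := by positivity
      calc _ ≤ _ := norm_sub_le _ _
        _ ≤ _ := by rw [hM]; linarith
    · rw [min_eq_right h, e, norm_smul, hexp, one_mul]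
      refine (hlip (t - s) t).trans ?_
      rw [sub_sub_cancel, Real.norm_eq_abs]
      have h1 : α * ‖z‖ + ‖χ‖ ≤ δ * M := by
        rw [hM, mul_add, mul_div_cancel₀ _ hδ.ne']
        gcongr
      have h2 : (α * ‖z‖ + ‖χ‖) * |s| ≤ δ * M * |s| := by gcongr
      have h3 : 0 ≤ δ * M * |s| := by positivity
      linarith
  have hfe : Integrable fun s : ℝ => f s * Complex.exp (-μ * s) := by
    have := hf.mul_bdd (c := 1) (g := fun s : ℝ => Complex.exp (-μ * s))
      (Continuous.aestronglyMeasurable (by fun_prop)) (ae_of_all _ fun s => (hexp' s).le)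
    exact this
  have hfm : Integrable fun s : ℝ => ‖f s‖ * min 1 (δ * |s|) := by
    refine hf.norm.mul_bdd (c := 1) (Continuous.aestronglyMeasurable (by fun_prop)) ?_
    refine ae_of_all _ fun s => ?_
    rw [Real.norm_of_nonneg (le_min zero_le_one (by positivity))]
    exact min_le_left _ _
  have hpt : ∀ t, ‖c‖ * ‖z t‖ ≤ M * (‖c‖ / 2) := by
    intro t
    have hfz' : Integrable fun s : ℝ => f s • z (t - s) :=
      Integrable.smul_bdd hf ‖z‖ (Continuous.aestronglyMeasurable (by fun_prop))
        (ae_of_all _ fun s => norm_coe_le_norm _ _)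
    -- Since `f * z = 0`, the term `z (t - s)` may be subtracted under the integral defining `c`.
    have e : c • z t = ∫ s : ℝ, f s • (Complex.exp (-μ * s) • z t - z (t - s)) := by
      simp only [smul_sub, smul_smul]
      rw [integral_sub (hfe.smul_const _) hfz', hfz t, integral_smul_const, sub_zero]
    rw [← norm_smul, e]
    calc _ ≤ ∫ s : ℝ, 2 * M * (‖f s‖ * min 1 (δ * |s|)) := by
          refine norm_integral_le_of_norm_le (hfm.const_mul _) (ae_of_all _ fun s => ?_)
          rw [norm_smul]
          calc _ ≤ ‖f s‖ * (2 * M * min 1 (δ * |s|)) := by gcongr; exact hdiff t s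
            _ = _ := by ring
      _ = 2 * M * ∫ s : ℝ, ‖f s‖ * min 1 (δ * |s|) := integral_const_mul _ _
      _ ≤ 2 * M * (‖c‖ / 4) := by gcongr
      _ = _ := by ring
  have hz2 : ‖z‖ ≤ M / 2 := by
    refine (norm_le (by positivity)).2 fun t => ?_
    refine le_of_mul_le_mul_left ?_ hcpos
    linarith [hpt t]
  rw [hM] at hz2
  linarith

/-- The complex number `μ` does not resonate with the functions in `N`: either it is not imaginary,
or there is an integrable function annihilating `N` by convolution whose Fourier-Laplace transform
does not vanish at `μ`. -/
def IsNonresonant (N : Submodule ℂ (ℝ →ᵇ X)) (μ : ℂ) : Prop :=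
  μ.re ≠ 0 ∨ ∃ f : ℝ → ℂ, Integrable f ∧ (∀ χ ∈ N, ∀ t, ∫ s, f s • χ (t - s) = 0) ∧
    ∫ s : ℝ, f s * Complex.exp (-μ * s) ≠ 0

lemma IsNonresonant.mono {N N' : Submodule ℂ (ℝ →ᵇ X)} {μ : ℂ} (h : IsNonresonant N μ)
    (hN : N' ≤ N) : IsNonresonant N' μ :=
  h.imp_right fun ⟨f, hf, h1, h2⟩ => ⟨f, hf, fun χ hχ => h1 χ (hN hχ), h2⟩

variable {N : Submodule ℂ (ℝ →ᵇ X)} [CompleteSpace X]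

/-- The equation `v' = μ v + ψ` is solvable in a translation space if `μ` is nonresonant. -/
lemma exists_hasDerivAt_of_isNonresonant (hN : IsTranslationSpace N) {μ : ℂ}
    (hμ : IsNonresonant N μ) {ψ : ℝ →ᵇ X} (hψ : ψ ∈ N) :
    ∃ v ∈ N, ∀ t, HasDerivAt v (μ • v t + ψ t) t := by
  by_cases hre : μ.re ≠ 0
  · exact hN.exists_hasDerivAt_of_re_ne_zero hre hψ
  obtain ⟨f, hf, hfN, hc⟩ := hμ.resolve_left hre
  rw [not_not] at hre
  obtain ⟨δ, hδ, hest⟩ := exists_norm_le_of_hasDerivAt (X := X) hf hre hc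
  set α : ℕ → ℝ := fun k => δ * (1 / ((k : ℝ) + 1)) with hα
  have hα0 : ∀ k, 0 < α k := fun k => by positivity
  have hα1 : ∀ k, α k ≤ δ := fun k => by
    refine mul_le_of_le_one_right hδ.le ?_
    rw [div_le_one (by positivity)]
    linarith [(Nat.cast_nonneg k : (0 : ℝ) ≤ k)]
  have hαlim : Tendsto α atTop (𝓝 0) := by
    rw [← mul_zero δ]
    exact (tendsto_one_div_add_atTop_nhds_zero_nat (𝕜 := ℝ)).const_mul δ
  have hex : ∀ k, ∃ v ∈ N, ∀ t, HasDerivAt v ((μ + α k) • v t + ψ t) t := fun k =>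
    hN.exists_hasDerivAt_of_re_pos (by simpa [hre] using hα0 k) hψ
  choose v hvN hvd using hex
  have hv : ∀ k, ‖v k‖ ≤ ‖ψ‖ / δ := fun k =>
    hest (α k) (hα0 k).le (hα1 k) (v k) ψ (hfN _ (hvN k)) (hvd k)
  set C : ℝ := ‖ψ‖ / δ / δ with hC
  -- The difference `v k - v l` solves the equation for `μ + α k` with forcing `(α k - α l) • v l`,
  -- so the uniform estimate applies a second time.
  have hdist : ∀ k l, dist (v k) (v l) ≤ C * dist (α k) (α l) := by
    intro k l
    rw [dist_eq_norm, dist_eq_norm]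
    have h := hest (α k) (hα0 k).le (hα1 k) (v k - v l) (((α k - α l : ℝ) : ℂ) • v l)
      (hfN _ (N.sub_mem (hvN k) (hvN l))) (fun t => by
        refine ((hvd k t).sub (hvd l t)).congr_deriv ?_
        change _ = (μ + (α k : ℂ)) • (v k t - v l t) + ((α k - α l : ℝ) : ℂ) • v l t
        push_cast
        module)
    refine h.trans ?_
    rw [norm_smul, Complex.norm_real, hC, div_mul_eq_mul_div, mul_comm]
    gcongr
    exact hv l
  have hcau : CauchySeq v := by
    rw [Metric.cauchySeq_iff]
    intro ε hε
    have hC0 : 0 ≤ C := by positivity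
    obtain ⟨K, hK⟩ := Metric.cauchySeq_iff.1 hαlim.cauchySeq (ε / (C + 1)) (by positivity)
    refine ⟨K, fun m hm n hn => (hdist m n).trans_lt ?_⟩
    have := hK m hm n hn
    rw [lt_div_iff₀ (by positivity)] at this
    nlinarith [dist_nonneg (x := α m) (y := α n)]
  obtain ⟨w, hw⟩ := cauchySeq_tendsto_of_complete hcau
  refine ⟨w, hN.isClosed.mem_of_tendsto hw (Eventually.of_forall hvN), ?_⟩
  have hα' : Tendsto (fun k => μ + (α k : ℂ)) atTop (𝓝 μ) := by
    have := (Complex.continuous_ofReal.tendsto 0).comp hαlim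
    simpa using this.const_add μ
  -- The derivatives converge uniformly together with the functions, so the equation passes to the
  -- limit.
  have hlim : Tendsto (fun k => (μ + (α k : ℂ)) • v k + ψ) atTop (𝓝 (μ • w + ψ)) :=
    (hα'.smul hw).add_const ψ
  intro t
  exact hasDerivAt_of_tendstoUniformly (tendsto_iff_tendstoUniformly.1 hlim)
    (Eventually.of_forall hvd)
    (fun x => ((evalCLM ℂ x).continuous.tendsto w).comp hw) t

/-- The equation `w' = B w + ψ` is solvable in a `B`-invariant translation space annihilated by a
polynomial of `B` with nonresonant roots. -/
lemma exists_hasDerivAt_of_aeval (B : X →L[ℂ] X) (s : Multiset ℂ) :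
    ∀ N : Submodule ℂ (ℝ →ᵇ X), IsTranslationSpace N →
      (∀ χ ∈ N, B.compLeftContinuousBounded ℝ χ ∈ N) → (∀ μ ∈ s, IsNonresonant N μ) →
      (∀ χ ∈ N, ∀ t, Polynomial.aeval B
        (s.map fun μ => Polynomial.X - Polynomial.C μ).prod (χ t) = 0) →
      ∀ ψ ∈ N, ∃ w ∈ N, ∀ t, HasDerivAt w (B (w t) + ψ t) t := by
  -- The space `N` is quantified inside the induction because each step passes to a smaller one.
  induction s using Multiset.induction_on with
  | empty =>
    intro N _ _ _ h0 ψ hψ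
    refine ⟨0, N.zero_mem, fun t => ?_⟩
    have : ψ t = 0 := by simpa using h0 ψ hψ t
    simp [this]
  | cons μ s ih =>
    intro N hN hB hs h0 ψ hψ
    -- With `v' = μ v + ψ`, the sum `v + w` solves the system as soon as `w' = B w + (B v - μ v)`;
    -- the new forcing is killed by the product `Q` of the remaining factors.
    obtain ⟨v, hvN, hv⟩ := hN.exists_hasDerivAt_of_isNonresonant
      (hs μ (Multiset.mem_cons_self _ _)) hψ
    set q : Polynomial ℂ := (s.map fun μ => Polynomial.X - Polynomial.C μ).prod with hq
    set Q : X →L[ℂ] X := Polynomial.aeval B q with hQ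
    have hcomm : ∀ x, Q (B x) = B (Q x) := fun x => by
      have : Q * B = B * Q := by
        have h := congrArg (Polynomial.aeval B) (mul_comm q Polynomial.X)
        simpa using h
      exact congrArg (fun T : X →L[ℂ] X => T x) this
    have h0' : ∀ χ ∈ N, ∀ t, Q (B (χ t) - μ • χ t) = 0 := fun χ hχ t => by
      have h := h0 χ hχ t
      rw [Multiset.map_cons, Multiset.prod_cons, mul_comm, map_mul] at h
      simpa [Polynomial.aeval_C, Algebra.algebraMap_eq_smul_one] using h
    set N' : Submodule ℂ (ℝ →ᵇ X) :=
      N ⊓ (Q.compLeftContinuousBounded ℝ).toLinearMap.ker with hN'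
    have hmem : ∀ χ, χ ∈ N' ↔ χ ∈ N ∧ ∀ t, Q (χ t) = 0 := fun χ => by
      rw [hN', Submodule.mem_inf, LinearMap.mem_ker]
      exact and_congr_right fun _ => DFunLike.ext_iff
    have hle : N' ≤ N := inf_le_left
    have hT : IsTranslationSpace N' :=
      { isClosed := hN.isClosed.inter (Q.compLeftContinuousBounded ℝ).isClosed_ker
        uniformContinuous := fun χ hχ => hN.uniformContinuous χ (hle hχ)
        translate_mem := fun χ hχ a => by
          rw [hmem] at hχ ⊢
          exact ⟨hN.translate_mem χ hχ.1 a, fun t => hχ.2 (a + t)⟩ }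
    obtain ⟨w, hwN, hw⟩ := ih N' hT
      (fun χ hχ => by
        rw [hmem] at hχ ⊢
        refine ⟨hB χ hχ.1, fun t => ?_⟩
        change Q (B (χ t)) = 0
        rw [hcomm, hχ.2 t, map_zero])
      (fun ν hν => (hs ν (Multiset.mem_cons_of_mem hν)).mono hle)
      (fun χ hχ => ((hmem χ).1 hχ).2)
      (B.compLeftContinuousBounded ℝ v - μ • v)
      ((hmem _).2 ⟨N.sub_mem (hB v hvN) (N.smul_mem μ hvN), h0' v hvN⟩)
    refine ⟨v + w, N.add_mem hvN (hle hwN), fun t => ?_⟩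
    refine ((hv t).add (hw t)).congr_deriv ?_
    change μ • v t + ψ t + (B (w t) + (B (v t) - μ • v t)) = B (v t + w t) + ψ t
    rw [map_add]
    abel

end Resonance

/-! ### Increments of a bounded function, mild solutions, and convolution. -/

section Increments

lemma intervalIntegrable_of_norm_le {X : Type*} [NormedAddCommGroup X] {φ : ℝ → X}
    (hφ : StronglyMeasurable φ) {C : ℝ} (hC : ∀ t, ‖φ t‖ ≤ C) (a b : ℝ) : IntervalIntegrable φ volume a b :=
  (intervalIntegrable_const (c := C)).mono_fun hφ.aestronglyMeasurable
    (ae_of_all _ fun t => (hC t).trans (le_abs_self C))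

variable {X : Type*} [NormedAddCommGroup X] [NormedSpace ℂ X]

/-- Membership is asked only on `S`, since increments are known to lie in `N` only for positive
step. -/
lemma setIntegral_mem_of_isClosed {E α : Type*} [NormedAddCommGroup E] [NormedSpace ℂ E]
    [CompleteSpace E] [MeasurableSpace α] {μ : Measure α} {N : Submodule ℂ E}
    (hN : IsClosed (N : Set E)) {S : Set α} (hS : MeasurableSet S) {f : α → E}
    (hf : ∀ x ∈ S, f x ∈ N) : ∫ x in S, f x ∂μ ∈ N := by
  rw [← integral_indicator hS]
  refine integral_mem_of_isClosed hN fun x => ?_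
  by_cases hx : x ∈ S
  · simpa [hx] using hf x hx
  · simp [hx]

lemma norm_integral_sub_integral_le {φ : ℝ → X} (hφ : StronglyMeasurable φ) {C : ℝ}
    (hC : ∀ t, ‖φ t‖ ≤ C) (c a b : ℝ) :
    ‖(∫ r in c..b, φ r) - ∫ r in c..a, φ r‖ ≤ C * |b - a| := by
  rw [intervalIntegral.integral_interval_sub_left (intervalIntegrable_of_norm_le hφ hC _ _)
    (intervalIntegrable_of_norm_le hφ hC _ _)]
  exact intervalIntegral.norm_integral_le_of_norm_le_const fun t _ => hC t

lemma continuous_primitive_of_norm_le {φ : ℝ → X} (hφ : StronglyMeasurable φ) {C : ℝ}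
    (hC : ∀ t, ‖φ t‖ ≤ C) (c : ℝ) : Continuous fun t => ∫ r in c..t, φ r :=
  intervalIntegral.continuous_primitive (intervalIntegrable_of_norm_le hφ hC) c

lemma integral_add_eq_sub {φ : ℝ → X} (hφ : StronglyMeasurable φ) {C : ℝ}
    (hC : ∀ t, ‖φ t‖ ≤ C) (h t : ℝ) :
    ∫ r in t..t + h, φ r = (∫ r in (0 : ℝ)..t + h, φ r) - ∫ r in (0 : ℝ)..t, φ r :=
  (intervalIntegral.integral_interval_sub_left (intervalIntegrable_of_norm_le hφ hC _ _)
    (intervalIntegrable_of_norm_le hφ hC _ _)).symm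

/-- The function `t ↦ ∫_t^{t+h} φ` for a bounded measurable `φ`. -/
noncomputable def incrementBCF {φ : ℝ → X} (hφ : StronglyMeasurable φ) {C : ℝ}
    (hC : ∀ t, ‖φ t‖ ≤ C) (h : ℝ) : ℝ →ᵇ X :=
  ofNormedAddCommGroup (fun t => ∫ r in t..t + h, φ r)
    (by
      simp only [integral_add_eq_sub hφ hC]
      have := continuous_primitive_of_norm_le hφ hC 0
      fun_prop)
    (C * |h|) fun t => by
      simpa using intervalIntegral.norm_integral_le_of_norm_le_const (a := t) (b := t + h)
        fun x _ => hC x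

@[simp] lemma incrementBCF_apply {φ : ℝ → X} (hφ : StronglyMeasurable φ) {C : ℝ}
    (hC : ∀ t, ‖φ t‖ ≤ C) (h t : ℝ) : incrementBCF hφ hC h t = ∫ r in t..t + h, φ r := rfl

lemma uniformContinuous_incrementBCF {φ : ℝ → X} (hφ : StronglyMeasurable φ) {C : ℝ}
    (hC : ∀ t, ‖φ t‖ ≤ C) (h : ℝ) : UniformContinuous (incrementBCF hφ hC h) := by
  have hC0 : 0 ≤ C := (norm_nonneg _).trans (hC 0)
  refine (LipschitzWith.of_dist_le_mul (K := (2 * C).toNNReal) fun a b => ?_).uniformContinuous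
  rw [Real.coe_toNNReal _ (by positivity), dist_eq_norm, dist_eq_norm, incrementBCF_apply,
    incrementBCF_apply, integral_add_eq_sub hφ hC, integral_add_eq_sub hφ hC, sub_sub_sub_comm]
  have h1 := norm_integral_sub_integral_le hφ hC 0 (b + h) (a + h)
  have h2 := norm_integral_sub_integral_le hφ hC 0 b a
  rw [add_sub_add_right_eq_sub] at h1
  refine (norm_sub_le _ _).trans ?_
  rw [Real.norm_eq_abs]
  linarith

/-- Continuity in the step, for the sup norm, is what permits averaging increments as elements of
`N`. -/
lemma continuous_incrementBCF {φ : ℝ → X} (hφ : StronglyMeasurable φ) {C : ℝ}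
    (hC : ∀ t, ‖φ t‖ ≤ C) : Continuous (incrementBCF hφ hC) := by
  have hC0 : 0 ≤ C := (norm_nonneg _).trans (hC 0)
  refine (LipschitzWith.of_dist_le_mul (K := C.toNNReal) fun a b => ?_).continuous
  rw [Real.coe_toNNReal _ hC0]
  refine (dist_le (by positivity)).2 fun t => ?_
  have h1 := norm_integral_sub_integral_le hφ hC t (t + b) (t + a)
  rwa [add_sub_add_left_eq_sub, ← dist_eq_norm, ← Real.dist_eq] at h1

variable {N : Submodule ℂ (ℝ →ᵇ X)}

/-- If the increments of `φ` lie in a translation space, then `φ` is the sum of a function in this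
space and the derivative of a function in this space. -/
lemma exists_primitive_sub_increment [CompleteSpace X] (hN : IsTranslationSpace N)
    {φ : ℝ → X} (hφ : StronglyMeasurable φ) {C : ℝ} (hC : ∀ t, ‖φ t‖ ≤ C)
    (hD : ∀ h, 0 < h → incrementBCF hφ hC h ∈ N) :
    ∃ v ∈ N, ∀ t, v t - v 0 =
      (∫ s in (0 : ℝ)..t, φ s) - ∫ s in (0 : ℝ)..t, incrementBCF hφ hC 1 s := by
  set P : ℝ → X := fun t => ∫ r in (0 : ℝ)..t, φ r with hP
  have hPc : Continuous P := continuous_primitive_of_norm_le hφ hC 0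
  -- With `P` a primitive of `φ`, this witness is `P t - ∫_t^{t+1} P`, and the subtracted average
  -- has the increment of step `1` as its derivative.
  refine ⟨-∫ s in Set.Ioc (0 : ℝ) 1, incrementBCF hφ hC s, N.neg_mem
    (setIntegral_mem_of_isClosed hN.isClosed measurableSet_Ioc fun s hs => hD s hs.1), ?_⟩
  set v : ℝ →ᵇ X := -∫ s in Set.Ioc (0 : ℝ) 1, incrementBCF hφ hC s with hv
  set G : ℝ → X := fun t => (∫ r in (0 : ℝ)..t + 1, P r) - ∫ r in (0 : ℝ)..t, P r with hG
  have hvt : ∀ t, v t = P t - G t := by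
    intro t
    have hI : IntegrableOn (fun s => incrementBCF hφ hC s) (Set.Ioc 0 1) :=
      (continuous_incrementBCF hφ hC).integrableOn_Ioc
    have h1 : v t = -∫ s in (0 : ℝ)..1, (P (t + s) - P t) := by
      rw [hv, coe_neg, Pi.neg_apply, intervalIntegral.integral_of_le zero_le_one]
      congr 1
      refine ((evalCLM ℂ t).integral_comp_comm hI).symm.trans ?_
      refine integral_congr_ae (ae_of_all _ fun s => ?_)
      exact integral_add_eq_sub hφ hC s t
    have h2 : ∫ s in (0 : ℝ)..1, P (t + s) = G t := by
      rw [intervalIntegral.integral_comp_add_left, add_zero, hG]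
      exact (intervalIntegral.integral_interval_sub_left (hPc.intervalIntegrable _ _)
        (hPc.intervalIntegrable _ _)).symm
    have h3 : IntervalIntegrable (fun s => P (t + s)) volume 0 1 :=
      (hPc.comp (continuous_const.add continuous_id)).intervalIntegrable _ _
    rw [h1, intervalIntegral.integral_sub h3 intervalIntegrable_const, h2]
    simp
  have hGd : ∀ t, HasDerivAt G (incrementBCF hφ hC 1 t) t := by
    intro t
    have hQ : ∀ x, HasDerivAt (fun x => ∫ r in (0 : ℝ)..x, P r) (P x) x := fun x =>
      intervalIntegral.integral_hasDerivAt_right (hPc.intervalIntegrable _ _)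
        (hPc.stronglyMeasurableAtFilter _ _) hPc.continuousAt
    rw [incrementBCF_apply, integral_add_eq_sub hφ hC]
    exact ((hQ (t + 1)).comp_add_const t 1).sub (hQ t)
  intro t
  rw [intervalIntegral.integral_eq_sub_of_hasDerivAt (fun x _ => hGd x)
    ((incrementBCF hφ hC 1).continuous.intervalIntegrable _ _), hvt, hvt]
  have : P 0 = 0 := by simp [hP]
  rw [this]
  simp only [hP]
  abel

/-- If `w' = B w + ψ` is solvable in a `B`-invariant translation space for all `ψ` in this space,
then `u' = B u + φ` has a mild solution in it for all `φ` with increments in it. -/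
lemma exists_isMildSolution [CompleteSpace X] (hN : IsTranslationSpace N) {φ : ℝ → X}
    (hφ : StronglyMeasurable φ) {C : ℝ} (hC : ∀ t, ‖φ t‖ ≤ C)
    (hD : ∀ h, 0 < h → incrementBCF hφ hC h ∈ N) (B : X →L[ℂ] X)
    (hB : ∀ χ ∈ N, B.compLeftContinuousBounded ℝ χ ∈ N)
    (hsolve : ∀ ψ ∈ N, ∃ w ∈ N, ∀ t, HasDerivAt w (B (w t) + ψ t) t) :
    ∃ u ∈ N, IsMildSolution B φ u := by
  obtain ⟨v, hvN, hv⟩ := hN.exists_primitive_sub_increment hφ hC hD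
  set D := incrementBCF hφ hC 1 with hDdef
  -- Only `w` has to be differentiable: the irregular part of `φ` is carried by `v`, which enters
  -- the equation for `w` through `B v`.
  obtain ⟨w, hwN, hw⟩ := hsolve (B.compLeftContinuousBounded ℝ v + D)
    (N.add_mem (hB v hvN) (hD 1 one_pos))
  refine ⟨v + w, N.add_mem hvN hwN, (v + w).continuous, fun t => ?_⟩
  have hvi : IntervalIntegrable v volume 0 t := v.continuous.intervalIntegrable _ _
  have hwi : IntervalIntegrable w volume 0 t := w.continuous.intervalIntegrable _ _
  have hDi : IntervalIntegrable D volume 0 t := D.continuous.intervalIntegrable _ _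
  have hBv : IntervalIntegrable (fun s => B (v s)) volume 0 t :=
    (B.continuous.comp v.continuous).intervalIntegrable _ _
  have hBw : IntervalIntegrable (fun s => B (w s)) volume 0 t :=
    (B.continuous.comp w.continuous).intervalIntegrable _ _
  have h1 : ∫ s in (0 : ℝ)..t, (B (w s) + (B (v s) + D s)) = w t - w 0 :=
    intervalIntegral.integral_eq_sub_of_hasDerivAt (fun x _ => hw x) (hBw.add (hBv.add hDi))
  rw [intervalIntegral.integral_add hBw (hBv.add hDi), intervalIntegral.integral_add hBv hDi,
    B.intervalIntegral_comp_comm hwi, B.intervalIntegral_comp_comm hvi] at h1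
  have h2 := hv t
  have h3 : ∫ s in (0 : ℝ)..t, (v + w) s = (∫ s in (0 : ℝ)..t, v s) + ∫ s in (0 : ℝ)..t, w s :=
    intervalIntegral.integral_add hvi hwi
  rw [h3, map_add]
  change v t + w t = v 0 + w 0 + _ + _
  rw [sub_eq_iff_eq_add] at h2
  have h4 : w t = (B (∫ s in (0 : ℝ)..t, w s) + (B (∫ s in (0 : ℝ)..t, v s) +
    ∫ s in (0 : ℝ)..t, D s)) + w 0 := (sub_eq_iff_eq_add.1 h1.symm)
  rw [h2, h4]
  abel

/-- Evaluation at `t` of the convolution with an integrable function `f`. -/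
noncomputable def convolutionCLM (f : ℝ → ℂ) (hf : Integrable f) (t : ℝ) :
    (ℝ →ᵇ X) →L[ℂ] X :=
  have hI : ∀ ψ : ℝ →ᵇ X, Integrable fun s => f s • ψ (t - s) := fun ψ =>
    Integrable.smul_bdd hf ‖ψ‖ (Continuous.aestronglyMeasurable (by fun_prop))
        (ae_of_all _ fun s => norm_coe_le_norm _ _)
  LinearMap.mkContinuous
    { toFun := fun ψ => ∫ s, f s • ψ (t - s)
      map_add' := fun ψ χ => by
        simp only [coe_add, Pi.add_apply, smul_add]
        exact integral_add (hI ψ) (hI χ)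
      map_smul' := fun c ψ => by
        simp only [coe_smul, RingHom.id_apply]
        rw [← integral_smul]
        simp only [smul_comm c] }
    (∫ s, ‖f s‖) fun ψ => by
      rw [← integral_mul_const]
      refine norm_integral_le_of_norm_le (hf.norm.mul_const _) (ae_of_all _ fun s => ?_)
      rw [norm_smul]
      gcongr
      exact norm_coe_le_norm _ _

lemma convolutionCLM_apply (f : ℝ → ℂ) (hf : Integrable f) (t : ℝ) (ψ : ℝ →ᵇ X) :
    convolutionCLM f hf t ψ = ∫ s, f s • ψ (t - s) := rfl

/-- If convolution with `f` annihilates `φ`, then it annihilates the increments of `φ`. -/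
lemma convolutionCLM_incrementBCF {φ : ℝ → X} (hφ : StronglyMeasurable φ) {C : ℝ}
    (hC : ∀ t, ‖φ t‖ ≤ C) {f : ℝ → ℂ} (hf : Integrable f)
    (h0 : ∀ t, ∫ s, f s • φ (t - s) = 0) {h : ℝ} (hh : 0 < h) (t : ℝ) :
    convolutionCLM f hf t (incrementBCF hφ hC h) = 0 := by
  rw [convolutionCLM_apply]
  have hprod : Integrable (Function.uncurry fun s r : ℝ => f s • φ (t - s + r))
      (volume.prod (volume.restrict (Set.Ioc 0 h))) := by
    refine (hf.norm.mul_prod (integrable_const C)).mono' ?_ (ae_of_all _ fun p => ?_)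
    · refine hf.aestronglyMeasurable.comp_fst.smul ?_
      exact (hφ.comp_measurable (by fun_prop :
        Measurable fun p : ℝ × ℝ => t - p.1 + p.2)).aestronglyMeasurable
    · simp only [Function.uncurry, norm_smul]
      gcongr
      exact hC _
  have h1 : ∀ s, f s • incrementBCF hφ hC h (t - s) =
      ∫ r in Set.Ioc 0 h, f s • φ (t - s + r) := fun s => by
    rw [incrementBCF_apply, integral_smul, ← intervalIntegral.integral_of_le hh.le,
      intervalIntegral.integral_comp_add_left, add_zero]
  simp only [h1]
  -- An increment is an integral of translates of `φ`, and `f` annihilates every translate.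
  rw [integral_integral_swap hprod]
  have h2 : ∀ r, ∫ s, f s • φ (t - s + r) = 0 := fun r => by
    simpa only [sub_add_eq_add_sub] using h0 (t + r)
  simp only [h2, integral_zero]

end Increments

end IsTranslationSpace

/-! ### The space of class members annihilated along with `φ`. -/

open BoundedContinuousFunction IsTranslationSpace

/-- The bounded uniformly continuous functions with restriction in the class `F` that are
annihilated by all integrable functions annihilating `φ` by convolution. -/
noncomputable def annihilatedClass {X : Type*} [NormedAddCommGroup X] [NormedSpace ℂ X]
    {J : Set ℝ} (F : Submodule ℂ (J → X)) (φ : ℝ → X) : Submodule ℂ (ℝ →ᵇ X) where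
  carrier := {ψ | UniformContinuous ψ ∧ J.domRestrict ψ ∈ F ∧
    ∀ (f : ℝ → ℂ) (hf : Integrable f), (∀ t, ∫ s, f s • φ (t - s) = 0) →
      ∀ t, convolutionCLM f hf t ψ = 0}
  zero_mem' := ⟨uniformContinuous_const, F.zero_mem, fun f hf _ t => map_zero _⟩
  add_mem' := fun h1 h2 => ⟨h1.1.add h2.1, F.add_mem h1.2.1 h2.2.1, fun f hf h t => by
    rw [map_add, h1.2.2 f hf h t, h2.2.2 f hf h t, add_zero]⟩
  smul_mem' := fun c _ h1 => ⟨h1.1.const_smul c, F.smul_mem c h1.2.1, fun f hf h t => by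
    rw [map_smul, h1.2.2 f hf h t, smul_zero]⟩

lemma isBUC_of_uniformContinuous {X : Type*} [NormedAddCommGroup X] {ψ : ℝ →ᵇ X}
    (h : UniformContinuous ψ) : IsBUC ψ :=
  ⟨h, ‖ψ‖, norm_coe_le_norm ψ⟩

section

variable {X : Type*} [NormedAddCommGroup X] [NormedSpace ℂ X] {J : Set ℝ}
  {F : Submodule ℂ (J → X)}

/-- The axioms of `F` handle the restriction. Annihilation is a closed condition because convolution
evaluated at a point is continuous, and it is translation invariant because it is required at every
`t`. -/
lemma isTranslationSpace_annihilatedClass (hF : IsBUCInvariantClass F) (φ : ℝ → X) :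
    IsTranslationSpace (annihilatedClass F φ) where
  isClosed := by
    refine IsSeqClosed.isClosed fun ψ χ hψ hlim => ?_
    have hu := tendsto_iff_tendstoUniformly.1 hlim
    refine ⟨hu.uniformContinuous (Eventually.of_forall fun k => (hψ k).1).frequently, ?_, ?_⟩
    · refine hF.uniform_limit (fun k => J.domRestrict (ψ k)) _ (fun k => ⟨(hψ k).2.1, ?_⟩) ?_
      · exact ⟨(hψ k).1.comp uniformContinuous_subtype_val, ‖ψ k‖, fun t => norm_coe_le_norm _ _⟩
      · exact hu.comp Subtype.val
    · intro f hf h0 t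
      refine tendsto_nhds_unique (((convolutionCLM f hf t).continuous.tendsto χ).comp hlim) ?_
      refine tendsto_const_nhds.congr fun k => ?_
      exact ((hψ k).2.2 f hf h0 t).symm
  uniformContinuous ψ hψ := hψ.1
  translate_mem ψ hψ a := by
    refine ⟨hψ.1.comp (uniformContinuous_const.add uniformContinuous_id),
      hF.translate ψ (isBUC_of_uniformContinuous hψ.1) hψ.2.1 a, fun f hf h0 t => ?_⟩
    rw [convolutionCLM_apply]
    simpa only [convolutionCLM_apply, translateBCF_apply, add_sub_assoc] using
      hψ.2.2 f hf h0 (a + t)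

lemma compLeftContinuousBounded_mem_annihilatedClass [CompleteSpace X]
    (hF : IsBUCInvariantClass F)
    {φ : ℝ → X} (B : X →L[ℂ] X) {ψ : ℝ →ᵇ X} (hψ : ψ ∈ annihilatedClass F φ) :
    B.compLeftContinuousBounded ℝ ψ ∈ annihilatedClass F φ := by
  refine ⟨B.uniformContinuous.comp hψ.1,
    hF.comp_clm ψ (isBUC_of_uniformContinuous hψ.1) hψ.2.1 B, fun f hf h0 t => ?_⟩
  have hI : Integrable fun s => f s • ψ (t - s) :=
    Integrable.smul_bdd hf ‖ψ‖ (Continuous.aestronglyMeasurable (by fun_prop))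
        (ae_of_all _ fun s => norm_coe_le_norm _ _)
  have h1 := hψ.2.2 f hf h0 t
  rw [convolutionCLM_apply] at h1 ⊢
  rw [← map_zero B, ← h1, ← B.integral_comp_comm hI]
  simp

/-- On a half line or the whole line, means of the restriction are restrictions of means. -/
lemma translationMean_domRestrict (hJ : J = Set.univ ∨ J = Set.Ici 0) {φ φ' : ℝ → X}
    (hφ : φ =ᵐ[volume] φ') {h : ℝ} (hh : 0 < h) :
    translationMean h (J.domRestrict φ) =
      fun t : J => ((h⁻¹ : ℝ) : ℂ) • ∫ r in (t : ℝ)..t + h, φ' r := by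
  funext t
  have hmem : ∀ s, 0 ≤ s → (t : ℝ) + s ∈ J := by
    intro s hs
    rcases hJ with rfl | rfl
    · trivial
    · exact add_nonneg t.2 hs
  have hae : ∀ᵐ s : ℝ, φ (t + s) = φ' (t + s) :=
    (measurePreserving_add_left volume (t : ℝ)).quasiMeasurePreserving.ae hφ
  have e : ∫ s in (0 : ℝ)..h, Function.extend Subtype.val (J.domRestrict φ) 0 ((t : ℝ) + s) =
      ∫ s in (0 : ℝ)..h, φ' (t + s) := by
    refine intervalIntegral.integral_congr_ae ?_
    filter_upwards [hae] with s hs hs'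
    rw [Set.uIoc_of_le hh.le] at hs'
    rw [← hs]
    exact Subtype.val_injective.extend_apply (J.domRestrict φ) 0 ⟨t + s, hmem s hs'.1.le⟩
  rw [translationMean, e, intervalIntegral.integral_comp_add_left, add_zero]

lemma incrementBCF_mem_annihilatedClass (hJ : J = Set.univ ∨ J = Set.Ici 0)
    [CompleteSpace X] {φ φ' : ℝ → X} (hφφ' : φ =ᵐ[volume] φ')
    (hφF : J.domRestrict φ ∈ meanClass (F : Set (J → X))) (hφ' : StronglyMeasurable φ') {C : ℝ}
    (hC : ∀ t, ‖φ' t‖ ≤ C) {h : ℝ} (hh : 0 < h) :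
    incrementBCF hφ' hC h ∈ annihilatedClass F φ' := by
  refine ⟨uniformContinuous_incrementBCF hφ' hC h, ?_, fun f hf h0 t =>
    convolutionCLM_incrementBCF hφ' hC hf h0 hh t⟩
  -- An increment is `h` times the mean over `[0, h]`.
  have h1 := F.smul_mem (h : ℂ) (hφF.2 h hh)
  rw [translationMean_domRestrict hJ hφφ' hh] at h1
  convert h1 using 1
  funext t
  have : (h : ℂ) ≠ 0 := by exact_mod_cast hh.ne'
  simp only [Pi.smul_apply, smul_smul]
  rw [Complex.ofReal_inv, mul_inv_cancel₀ this, one_smul]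
  rfl

end

/-- An essentially bounded function agrees almost everywhere with a bounded one. -/
lemma exists_stronglyMeasurable_norm_le {X : Type*} [NormedAddCommGroup X] {φ : ℝ → X}
    (hφ : MemLp φ ⊤ volume) :
    ∃ φ' : ℝ → X, StronglyMeasurable φ' ∧ φ =ᵐ[volume] φ' ∧ ∃ C : ℝ, ∀ t, ‖φ' t‖ ≤ C := by
  obtain ⟨ψ, hψ, hae⟩ := hφ.1
  set C : ℝ := (eLpNormEssSup φ volume).toReal with hCdef
  have hb : ∀ᵐ t, ‖φ t‖ ≤ C := by
    have h := ae_le_eLpNormEssSup (f := φ) (μ := (volume : Measure ℝ))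
    filter_upwards [h] with t ht
    have hfin : eLpNormEssSup φ volume ≠ ⊤ := eLpNorm_exponent_top.symm.trans_ne hφ.2.ne
    simpa using ENNReal.toReal_mono hfin ht
  have hS : MeasurableSet {t | ‖ψ t‖ ≤ C} := measurableSet_le hψ.norm.measurable measurable_const
  refine ⟨{t | ‖ψ t‖ ≤ C}.indicator ψ, hψ.indicator hS, ?_, C, fun t => ?_⟩
  · filter_upwards [hae, hb] with t h1 h2
    rw [h1] at h2 ⊢
    exact (Set.indicator_of_mem (s := {t | ‖ψ t‖ ≤ C}) h2 ψ).symm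
  · by_cases h : ‖ψ t‖ ≤ C
    · rw [Set.indicator_of_mem (s := {t | ‖ψ t‖ ≤ C}) h]; exact h
    · rw [Set.indicator_of_notMem (s := {t | ‖ψ t‖ ≤ C}) h, norm_zero]
      exact ENNReal.toReal_nonneg

/-! ### Matrices acting on `Y^n`, nonresonance of the eigenvalues, and the conclusion. -/

lemma matrixOperator_apply {n : ℕ} {Y : Type*} [NormedAddCommGroup Y] [NormedSpace ℂ Y]
    (A : Matrix (Fin n) (Fin n) ℂ) (x : Fin n → Y) (i : Fin n) :
    matrixOperator Y A x i = ∑ j, A i j • x j := by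
  simp [matrixOperator]

/-- The action of matrices on `Y^n` as a homomorphism of algebras. -/
noncomputable def matrixOperatorAlgHom (n : ℕ) (Y : Type*) [NormedAddCommGroup Y]
    [NormedSpace ℂ Y] : Matrix (Fin n) (Fin n) ℂ →ₐ[ℂ] ((Fin n → Y) →L[ℂ] (Fin n → Y)) where
  toFun := matrixOperator Y
  map_zero' := by ext; simp [matrixOperator]
  map_add' A B := by
    ext x i
    simp [matrixOperator, add_smul, Finset.sum_add_distrib]
  map_one' := by
    ext x i
    simp [matrixOperator, Matrix.one_apply, ite_smul]
  map_mul' A B := by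
    ext x i
    change matrixOperator Y (A * B) x i = matrixOperator Y A (matrixOperator Y B x) i
    simp only [matrixOperator_apply, Matrix.mul_apply, Finset.sum_smul, Finset.smul_sum,
      smul_smul]
    exact Finset.sum_comm
  commutes' c := by
    ext x i
    simp [matrixOperator, Matrix.algebraMap_matrix_apply, ite_smul,
      Algebra.algebraMap_eq_smul_one]

/-- Cayley-Hamilton carries over to the possibly infinite-dimensional `Y^n` because matrices act by
an algebra homomorphism. -/
lemma aeval_matrixOperator_charpoly {n : ℕ} (Y : Type*) [NormedAddCommGroup Y] [NormedSpace ℂ Y]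
    (A : Matrix (Fin n) (Fin n) ℂ) :
    Polynomial.aeval (matrixOperator Y A) A.charpoly = 0 := by
  have h := Polynomial.aeval_algHom_apply (matrixOperatorAlgHom n Y) A A.charpoly
  rw [Matrix.aeval_self_charpoly, map_zero] at h
  exact h

/-- If `ω` lies outside the spectrum, some `f` annihilates `φ` while its transform at `ω` is
nonzero; by construction of the space the same `f` annihilates all its members. -/
lemma isNonresonant_annihilatedClass {X : Type*} [NormedAddCommGroup X] [NormedSpace ℂ X]
    [CompleteSpace X] {J : Set ℝ} (F : Submodule ℂ (J → X)) {φ φ' : ℝ → X}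
    (hφφ' : φ =ᵐ[volume] φ') {μ : ℂ}
    (hμ : ∀ ω : ℝ, μ = Complex.I * ω → ω ∉ beurlingSpectrum φ) :
    IsNonresonant (annihilatedClass F φ') μ := by
  by_cases hre : μ.re = 0
  · have hμI : μ = Complex.I * (μ.im : ℂ) := by
      apply Complex.ext <;> simp [hre]
    have h := hμ μ.im hμI
    simp only [beurlingSpectrum, Set.mem_ofPred_eq, not_forall] at h
    obtain ⟨f, hf, h0, hne⟩ := h
    refine Or.inr ⟨f, hf, fun χ hχ t => hχ.2.2 f hf (fun t => ?_) t, fun h => hne ?_⟩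
    · rw [← h0 t]
      refine integral_congr_ae ?_
      have hae : ∀ᵐ s : ℝ, φ (t - s) = φ' (t - s) :=
        (Measure.measurePreserving_sub_left volume t).quasiMeasurePreserving.ae hφφ'
      filter_upwards [hae] with s hs
      rw [hs]
    · rw [← h, ← hμI]
      simp only [neg_mul]
  · exact Or.inl hre

theorem mainTheorem7 {n : ℕ} {Y : Type*} [NormedAddCommGroup Y] [NormedSpace ℂ Y]
    [CompleteSpace Y] (A : Matrix (Fin n) (Fin n) ℂ)
    (J : Set ℝ) (hJ : J = Set.univ ∨ J = Set.Ici 0)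
    (F : Submodule ℂ (J → Fin n → Y)) (hF : IsBUCInvariantClass F)
    (φ : ℝ → Fin n → Y) (hφ : MemLp φ ⊤ volume)
    (hφF : J.domRestrict φ ∈ meanClass (F : Set (J → Fin n → Y)))
    (hsp : ∀ ω ∈ beurlingSpectrum φ,
      ¬ Module.End.HasEigenvalue (Matrix.toLin' A) (Complex.I * (ω : ℂ))) :
    ∃ u : ℝ → Fin n → Y,
      IsMildSolution (matrixOperator Y A) φ u ∧ IsBUC u ∧ J.domRestrict u ∈ F := by
  -- Increments are built from an everywhere bounded representative; convolutions, means and the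
  -- mild equation see only its class modulo null sets.
  obtain ⟨φ', hφ', hae, C, hC⟩ := exists_stronglyMeasurable_norm_le hφ
  have hN := isTranslationSpace_annihilatedClass hF φ'
  have hB : ∀ χ ∈ annihilatedClass F φ',
      (matrixOperator Y A).compLeftContinuousBounded ℝ χ ∈ annihilatedClass F φ' :=
    fun χ hχ => compLeftContinuousBounded_mem_annihilatedClass hF _ hχ
  obtain ⟨u, hu, hcont, hmild⟩ := hN.exists_isMildSolution hφ' hC
    (fun h hh => incrementBCF_mem_annihilatedClass hJ hae hφF hφ' hC hh) (matrixOperator Y A) hB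
    -- The roots of the characteristic polynomial are the eigenvalues, hence nonresonant, and over
    -- `ℂ` the product of their linear factors is the whole polynomial.
    (exists_hasDerivAt_of_aeval _ A.charpoly.roots _ hN hB
      (fun μ hμ => isNonresonant_annihilatedClass F hae fun ω hω hmem => hsp ω hmem (by
        rw [← hω, Module.End.hasEigenvalue_iff_isRoot_charpoly, Matrix.charpoly_toLin']
        exact Polynomial.isRoot_of_mem_roots hμ))
      (fun χ _ t => by
        rw [← (IsAlgClosed.splits A.charpoly).eq_prod_roots_of_monic A.charpoly_monic,
          aeval_matrixOperator_charpoly, zero_apply]))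
  refine ⟨u, ⟨hcont, fun t => ?_⟩, isBUC_of_uniformContinuous hu.1, hu.2.1⟩
  rw [hmild t, intervalIntegral.integral_congr_ae (g := φ') (hae.mono fun s hs _ => hs)]
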